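/- Let $S_1,S_2$ be non-empty sets and let $\kappa$ be an infinite cardinal with $|S_1|,|S_2|<\kappa$. For $k=1,2$ let $A_k=(A_{k,s})_{s\in S_k}$ be an $S_k$-sorted algebra (carriers may be empty) of a type all of whose operation symbols have arity $<\kappa$, possibly infinite. Assume that the clone of term operations of $A_k$ is pure, that is, for all $s,t\in S_k$ there is a unary term with one variable of sort $s$ and value of sort $t$. Let $\kappa'$ be an infinite cardinal such that $|A_1|^\lambda<\kappa'$ and $|A_2|^\lambda<\kappa'$ for every cardinal $\lambda<\kappa$, where $|A_k|:=\prod_{s\in S_k}|A_{k,s}|$. Then the following are equivalent. 1. There is an equivalence of categories $\mathcal V(A_1)\to\mathcal V(A_2)$ that sends $A_1$ to $A_2$ (up to isomorphism), where $\mathcal V(A_k)$ is the variety generated by $A_k$, i.e. the category of all algebras of the type of $A_k$ satisfying every identity (between terms over any set of sorted variables) that holds in $A_k$, with all homomorphisms. 2. The $<\kappa'$-ary relational clones $\mathrm{Inv}_{<\kappa'}(A_1)$ and $\mathrm{Inv}_{<\kappa'}(A_2)$ are isomorphic. Here, for an $S$-sorted algebra $A$ as above, write $H(A)=\prod_{s\in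 S}A_s$. Then $\mathrm{Inv}_{<\kappa'}(A)=(\mathrm{Inv}_\mu(A))_{\mu<\kappa'}$, where $\mathrm{Inv}_\mu(A)$ is the set of all $r\subseteq H(A)^\mu$ such that, for every $\lambda<\kappa$, every family $(f_s)_{s\in S}$ of term operations $f_s:\prod_{(i,t)\in\lambda\times S}A_t\to A_s$, and all $(a_{i,j,t})_{(j,t)\in\mu\times S}\in r$ $(i\in\lambda)$, the tuple $\bigl(f_s(a_{i,j,t})_{(i,t)\in\lambda\times S}\bigr)_{(j,s)\in\mu\times S}$ belongs to $r$. A homomorphism $\mathrm{Inv}_{<\kappa'}(A)\to\mathrm{Inv}_{<\kappa'}(B)$ is a family of maps $\varphi_\mu:\mathrm{Inv}_\mu(A)\to\mathrm{Inv}_\mu(B)$ $(\mu<\kappa')$ that preserves primitive positive definitions: whenever $r_u\in\mathrm{Inv}_{\mu_u}(A)$ $(u\in U)$ with $\mu_u<\kappa'$, $f_u:\mu_u\to\mu\sqcup\nu$ are maps ($U$, $\nu$ arbitrary), and $r\in\mathrm{Inv}_\mu(A)$ is $$r=\{(a_j)_{j\in\mu}\in H(A)^\mu\mid \exists (a_j)_{j\in\nu}\in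 H(A)^\nu\ \forall u\in U:\ (a_{f_u(j)})_{j\in\mu_u}\in r_u\},$$ then $$\varphi_\mu(r)=\{(b_j)_{j\in\mu}\in H(B)^\mu\mid \exists (b_j)_{j\in\nu}\in H(B)^\nu\ \forall u\in U:\ (b_{f_u(j)})_{j\in\mu_u}\in \varphi_{\mu_u}(r_u)\}.$$ An isomorphism is a homomorphism with an inverse homomorphism. -/

import Mathlib

open CategoryTheory Cardinal

universe u

namespace ManySorted

/-- An `S`-sorted type (signature). The arity of an operation symbol is given as an index set
`Ar f`; only its cardinality matters. -/
structure Signature (S : Type u) where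
  Op : Type u
  Ar : Op → Type u
  dom : (f : Op) → Ar f → S
  cod : Op → S

/-- All operation symbols have arity strictly less than `κ`. -/
def Signature.IsAry {S : Type u} (F : Signature S) (κ : Cardinal.{u}) : Prop :=
  ∀ f : F.Op, #(F.Ar f) < κ

/-- An algebra of type `F`: an `S`-indexed family of (possibly empty) sets with operations. -/
structure Algebra {S : Type u} (F : Signature S) where
  carrier : S → Type u
  op : (f : F.Op) → ((i : F.Ar f) → carrier (F.dom f i)) → carrier (F.cod f)

/-- Homomorphisms of `F`-algebras. -/
@[ext]
structure Hom {S : Type u} {F : Signature S} (A B : Algebra F) where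
  toFun : (s : S) → A.carrier s → B.carrier s
  map_op : ∀ (f : F.Op) (a : (i : F.Ar f) → A.carrier (F.dom f i)),
    toFun (F.cod f) (A.op f a) = B.op f (fun i => toFun (F.dom f i) (a i))

/-- The category of all `F`-algebras. -/
instance {S : Type u} (F : Signature S) : Category (Algebra F) where
  Hom A B := Hom A B
  id A := { toFun := fun _ a => a, map_op := fun _ _ => rfl }
  comp {A B C} φ ψ :=
    { toFun := fun s a => ψ.toFun s (φ.toFun s a)
      map_op := fun f a => by rw [φ.map_op, ψ.map_op] }

/-- `Term F v s` is the set of `s`-valued terms whose variables are the elements `x` of `X`,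
the variable `x` being of sort `v x`. -/
inductive Term {S : Type u} (F : Signature S) {X : Type u} (v : X → S) : S → Type u
  | var (x : X) : Term F v (v x)
  | app (f : F.Op) (t : (i : F.Ar f) → Term F v (F.dom f i)) : Term F v (F.cod f)

/-- The term operation of a term on an algebra. -/
def Term.eval {S : Type u} {F : Signature S} {X : Type u} {v : X → S} (A : Algebra F)
    {s : S} (t : Term F v s) (a : (x : X) → A.carrier (v x)) : A.carrier s :=
  match t with
  | .var x => a x
  | .app f t => A.op f (fun i => (t i).eval A a)

/-- `Clo_{(X,v,s)}(A)`: the set of all `(X,v)`-ary `s`-valued term operations of `A`. -/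
def Clo {S : Type u} {F : Signature S} (A : Algebra F) {X : Type u} (v : X → S) (s : S) :
    Set (((x : X) → A.carrier (v x)) → A.carrier s) :=
  Set.range fun t : Term F v s => t.eval A

/-- The clone of term operations of `A` is pure: it has an operation `s₁ → s₂` for all
sorts `s₁`, `s₂`. -/
def HasPureClone {S : Type u} {F : Signature S} (A : Algebra F) : Prop :=
  ∀ s₁ s₂ : S, (Clo A (fun _ : PUnit.{u + 1} => s₁) s₂).Nonempty

/-- `A ⊨ t₁ = t₂`, for terms in the variables `(X, v)`. -/
def Satisfies {S : Type u} {F : Signature S} (A : Algebra F) {X : Type u} {v : X → S} {s : S}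
    (t₁ t₂ : Term F v s) : Prop :=
  t₁.eval A = t₂.eval A

/-- The variety generated by `A`: the class of all `F`-algebras that satisfy every identity
(with any set of variables) satisfied by `A`. -/
def variety {S : Type u} {F : Signature S} (A : Algebra F) : ObjectProperty (Algebra F) :=
  fun B => ∀ (X : Type u) (v : X → S) (s : S) (t₁ t₂ : Term F v s),
    Satisfies A t₁ t₂ → Satisfies B t₁ t₂

/-- The variety generated by `A` as a category, with all homomorphisms as morphisms. -/
abbrev VarietyCat {S : Type u} {F : Signature S} (A : Algebra F) : Type (u + 1) :=
  (variety A).FullSubcategory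

/-- The algebra `A` as an object of the variety it generates. -/
def VarietyCat.gen {S : Type u} {F : Signature S} (A : Algebra F) : VarietyCat A :=
  ⟨A, fun _ _ _ _ _ h => h⟩

/-- The product set `∏ s, A_s`. -/
abbrev Algebra.Total {S : Type u} {F : Signature S} (A : Algebra F) : Type u :=
  (s : S) → A.carrier s

/-- `Inv_μ(A)`: the `μ`-ary invariant sets of the `< κ`-ary algebra `A`, i.e. the subsets of
`(∏ s, A_s)^μ` closed under all `S`-tuples of term operations `f s` of type
`(L × S, (i, t) ↦ t) → s` with `|L| < κ`. -/
def Inv {S : Type u} {F : Signature S} (κ : Cardinal.{u}) (A : Algebra F) (μ : Type u) :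
    Set (Set (μ → A.Total)) :=
  {r | ∀ L : Type u, #L < κ →
    ∀ f : (s : S) → ((p : L × S) → A.carrier p.2) → A.carrier s,
      (∀ s, f s ∈ Clo A (fun p : L × S => p.2) s) →
      ∀ a : L → μ → A.Total, (∀ i, a i ∈ r) →
        (fun (j : μ) (s : S) => f s (fun p => a p.1 j p.2)) ∈ r}

/-- The `μ`-ary relation with primitive positive definition
`∃ (a_j)_{j ∈ ν}, ⋀_{c ∈ U} (a_{f c j})_{j ∈ I c} ∈ r c`, where the free variables are
`(a_j)_{j ∈ μ}` and each variable ranges over `T`. -/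
def ppDef {T : Type u} {μ ν U : Type u} {I : U → Type u}
    (f : (c : U) → I c → μ ⊕ ν) (r : (c : U) → Set (I c → T)) : Set (μ → T) :=
  {a | ∃ b : ν → T, ∀ c : U, (fun j => Sum.elim a b (f c j)) ∈ r c}

/-- Homomorphisms `Inv_{<κ'}(A) → Inv_{<κ'}(B)` of `< κ'`-ary relational clones: families of
maps `Inv_μ(A) → Inv_μ(B)`, for all index sets `μ` with `|μ| < κ'`, that preserve primitive
positive definitions. -/
structure RelCloneHom {S₁ S₂ : Type u} {F₁ : Signature S₁} {F₂ : Signature S₂}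
    (κ κ' : Cardinal.{u}) (A : Algebra F₁) (B : Algebra F₂) where
  toFun : (μ : Type u) → #μ < κ' → Inv κ A μ → Inv κ B μ
  map_ppDef : ∀ (μ ν U : Type u) (I : U → Type u) (hμ : #μ < κ') (hI : ∀ c, #(I c) < κ')
    (f : (c : U) → I c → μ ⊕ ν) (r : (c : U) → Inv κ A (I c)) (q : Inv κ A μ),
    (q : Set (μ → A.Total)) = ppDef f (fun c => (r c : Set (I c → A.Total))) →
    (toFun μ hμ q : Set (μ → B.Total)) =
      ppDef f (fun c => (toFun (I c) (hI c) (r c) : Set (I c → B.Total)))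

/-- The relational clones `Inv_{<κ'}(A)` and `Inv_{<κ'}(B)` are isomorphic. -/
def RelCloneIsomorphic {S₁ S₂ : Type u} {F₁ : Signature S₁} {F₂ : Signature S₂}
    (κ κ' : Cardinal.{u}) (A : Algebra F₁) (B : Algebra F₂) : Prop :=
  ∃ (φ : RelCloneHom κ κ' A B) (ψ : RelCloneHom κ κ' B A),
    (∀ (μ : Type u) (hμ : #μ < κ') (r : Inv κ A μ), ψ.toFun μ hμ (φ.toFun μ hμ r) = r) ∧
    (∀ (μ : Type u) (hμ : #μ < κ') (r : Inv κ B μ), φ.toFun μ hμ (ψ.toFun μ hμ r) = r)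

end ManySorted

namespace ManySorted

/-! ### Terms, powers and free algebras -/

variable {S S₁ S₂ : Type u} {F : Signature S} {F₁ : Signature S₁} {F₂ : Signature S₂}

/-! Both conditions are equivalent to a third one, `Linked`: there are families of maps `p : A_s →
B_t` and `q : B_t → A_s` such that `p` of an operation of `A` is a term of `B` in values `p' (a_i)`,
each composite `q ∘ p` is a unary term operation of `A`, and the identity of each `A_s` is a term of
`A` in such composites; likewise with `A` and `B` exchanged. These are equations, so they pass to
powers, subalgebras and quotients.

From a link to an equivalence: every algebra in the variety of `A` is a quotient of a free algebra,
which lies in a power of `A`, so the link can be carried over to it (`toTransport`). Homomorphisms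
correspond uniquely along links (`exists_rel`, `Rel.unique`), so transport is fully faithful; the
inverse link makes it essentially surjective.

From an equivalence `E` to a link: the symbols are the elements of `E (Free s)`, with `Free s` free
on one generator of sort `s`. An element `a` of `A_s` is a morphism `Free s → A`, and its image
under `E` sends each symbol into `E A ≅ B`.

For relations, purity and `#S < κ` turn invariant sets into subalgebras of powers (`invEquiv`). A
link moves these by taking preimages under all `q` (`mapRel`). Conversely, an isomorphism of
relational clones preserves inclusion, equality and change of coordinates. The unary term operations
on `A_s` form a relation of arity `|A_s|`, and the elements of its image are the symbols of a link.
The bounds on `κ'` ensure that this arity and that of the relation `∏ i, A_(dom f i)` are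
admissible. -/

theorem Hom.map_eval {A B : Algebra F} (h : Hom A B) {X : Type u} {v : X → S} {s : S}
    (t : Term F v s) (a : (x : X) → A.carrier (v x)) :
    h.toFun s (t.eval A a) = t.eval B (fun x => h.toFun (v x) (a x)) := by
  induction t with
  | var x => rfl
  | app f t ih => simp only [Term.eval, h.map_op, ih]

/-- The power `A ^ μ`. -/
def Algebra.pow (A : Algebra F) (μ : Type u) : Algebra F where
  carrier s := μ → A.carrier s
  op f a := fun j => A.op f (fun i => a i j)

theorem Term.eval_pow (A : Algebra F) {μ X : Type u} {v : X → S} {s : S} (t : Term F v s)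
    (a : (x : X) → μ → A.carrier (v x)) :
    t.eval (A.pow μ) a = fun j => t.eval A (fun x => a x j) := by
  induction t with
  | var x => rfl
  | app f t ih => simp only [Term.eval, ih]; rfl

/-- Substitution of terms for the variables of a term. -/
def Term.bind {X Y : Type u} {v : X → S} {w : Y → S} {s : S} (t : Term F v s)
    (σ : (x : X) → Term F w (v x)) : Term F w s :=
  match t with
  | .var x => σ x
  | .app f t => .app f (fun i => (t i).bind σ)

theorem Term.eval_bind (A : Algebra F) {X Y : Type u} {v : X → S} {w : Y → S} {s : S}
    (t : Term F v s) (σ : (x : X) → Term F w (v x)) (a : (y : Y) → A.carrier (w y)) :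
    (t.bind σ).eval A a = t.eval A (fun x => (σ x).eval A a) := by
  induction t with
  | var x => rfl
  | app f t ih => simp only [Term.bind, Term.eval, ih]

/-- A family of sets that is closed under the operations contains the values of terms. -/
theorem Term.eval_mem {A : Algebra F} {r : (s : S) → Set (A.carrier s)}
    (hr : ∀ (f : F.Op) (a : (i : F.Ar f) → A.carrier (F.dom f i)),
      (∀ i, a i ∈ r (F.dom f i)) → A.op f a ∈ r (F.cod f))
    {X : Type u} {v : X → S} {s : S} (t : Term F v s) (a : (x : X) → A.carrier (v x))
    (ha : ∀ x, a x ∈ r (v x)) : t.eval A a ∈ r s := by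
  induction t with
  | var x => exact ha x
  | app f t ih => exact hr f _ ih

theorem Clo.op_mem (A : Algebra F) {X : Type u} {v : X → S} (f : F.Op)
    (g : (i : F.Ar f) → ((x : X) → A.carrier (v x)) → A.carrier (F.dom f i))
    (hg : ∀ i, g i ∈ Clo A v (F.dom f i)) :
    (fun a => A.op f (fun i => g i a)) ∈ Clo A v (F.cod f) := by
  choose t ht using hg
  exact ⟨.app f t, by funext a; simp only [Term.eval, ht]⟩

theorem Clo.eval_mem (A : Algebra F) {X Y : Type u} {v : X → S} {w : Y → S} {s : S}
    (t : Term F w s) (g : (y : Y) → ((x : X) → A.carrier (v x)) → A.carrier (w y))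
    (hg : ∀ y, g y ∈ Clo A v (w y)) :
    (fun a => t.eval A (fun y => g y a)) ∈ Clo A v s := by
  choose σ hσ using hg
  exact ⟨t.bind σ, by funext a; simp only [Term.eval_bind, hσ]⟩

/-- The free algebra over the variables `(X, v)` in the variety generated by `A`, realized by
the term operations of `A`. -/
def Free (A : Algebra F) {X : Type u} (v : X → S) : Algebra F where
  carrier s := Clo A v s
  op f g := ⟨fun a => A.op f (fun i => (g i).1 a), Clo.op_mem A f _ (fun i => (g i).2)⟩

namespace Free

variable {A : Algebra F} {X : Type u} {v : X → S}

/-- The free generators. -/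
def gen (A : Algebra F) (v : X → S) (x : X) : (Free A v).carrier (v x) :=
  ⟨fun a => a x, .var x, rfl⟩

/-- The inclusion of the free algebra into the power of `A`. -/
def incl (A : Algebra F) (v : X → S) : Hom (Free A v) (A.pow ((x : X) → A.carrier (v x))) where
  toFun _ g := g.1
  map_op _ _ := rfl

theorem val_eval {Y : Type u} {w : Y → S} {s : S} (t : Term F w s)
    (g : (y : Y) → (Free A v).carrier (w y)) (a : (x : X) → A.carrier (v x)) :
    (t.eval (Free A v) g).1 a = t.eval A (fun y => (g y).1 a) :=
  (congrFun ((incl A v).map_eval t g) a).trans (congrFun (Term.eval_pow A t _) a)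

/-- `Free A v` sits inside a power of `A`, so identities can be checked pointwise. -/
theorem mem_variety (A : Algebra F) (v : X → S) : variety A (Free A v) := by
  intro Y w s t₁ t₂ h
  funext g
  refine Subtype.ext (funext fun a => ?_)
  rw [val_eval, val_eval, h]

theorem eval_gen {s : S} (t : Term F v s) :
    t.eval (Free A v) (gen A v) = ⟨t.eval A, t, rfl⟩ :=
  Subtype.ext (funext fun a => val_eval t _ a)

theorem exists_eval_gen {s : S} (g : (Free A v).carrier s) :
    ∃ t : Term F v s, t.eval (Free A v) (gen A v) = g :=
  let ⟨_, t, ht⟩ := g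
  ⟨t, (eval_gen t).trans (Subtype.ext ht)⟩

theorem hom_ext {C : Algebra F} {g h : Hom (Free A v) C}
    (H : ∀ x, g.toFun (v x) (gen A v x) = h.toFun (v x) (gen A v x)) : g = h := by
  refine Hom.ext (funext fun s => funext fun y => ?_)
  obtain ⟨t, rfl⟩ := exists_eval_gen y
  rw [g.map_eval, h.map_eval]
  simp only [H]

/-- Two terms with the same operation on `A` form an identity of `A`, hence of `C`. This makes
`lift` independent of the chosen term. -/
theorem eval_choose {C : Algebra F} (hC : variety A C) (c : (x : X) → C.carrier (v x)) {s : S}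
    (t : Term F v s) (h : t.eval A ∈ Clo A v s) : h.choose.eval C c = t.eval C c :=
  congrFun (hC X v s _ _ h.choose_spec) c

/-- The universal property of the free algebra. -/
noncomputable def lift {C : Algebra F} (hC : variety A C) (c : (x : X) → C.carrier (v x)) :
    Hom (Free A v) C where
  toFun _ g := g.2.choose.eval C c
  map_op f g' := by
    choose t ht using fun i => (g' i).2
    obtain rfl : g' = fun i => ⟨(t i).eval A, t i, rfl⟩ := funext fun i => Subtype.ext (ht i).symm
    refine (eval_choose hC c (.app f t) _).trans ?_
    simp only [Term.eval]
    congr 1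
    funext i
    exact (eval_choose hC c _ _).symm

@[simp]
theorem lift_gen {C : Algebra F} (hC : variety A C) (c : (x : X) → C.carrier (v x)) (x : X) :
    (lift hC c).toFun (v x) (gen A v x) = c x :=
  eval_choose hC c (.var x) _

theorem lift_self {s : S} (a : (x : X) → A.carrier (v x)) (g : (Free A v).carrier s) :
    (lift (VarietyCat.gen A).property a).toFun s g = g.1 a := by
  obtain ⟨g, t, rfl⟩ := g
  exact eval_choose (VarietyCat.gen A).property a t _

end Free

/-! ### Links between algebras of different types -/

/-- A family of unary symbols `P s t` from sorts `s` of `F₁` to sorts `t` of `F₂`, acting from the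
algebra `C` to the algebra `D`. -/
abbrev Action (P : S₁ → S₂ → Type u) (C : Algebra F₁) (D : Algebra F₂) : Type u :=
  (s : S₁) → (t : S₂) → P s t → C.carrier s → D.carrier t

/-- The terms occurring in the equations that express how unary symbols `P` from `F₁` to `F₂` and
`Q` from `F₂` to `F₁` interact with each other and with the operations of `F₁`. -/
structure LinkTerms (F₁ : Signature S₁) (F₂ : Signature S₂)
    (P : S₁ → S₂ → Type u) (Q : S₂ → S₁ → Type u) where
  opT : (f : F₁.Op) → (t : S₂) → P (F₁.cod f) t →
    Term F₂ (X := Σ i : F₁.Ar f, Σ t' : S₂, P (F₁.dom f i) t') (fun x => x.2.1) t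
  compT : (s : S₁) → (t : S₂) → (s' : S₁) → P s t → Q t s' →
    Term F₁ (X := PUnit.{u + 1}) (fun _ => s) s'
  recT : (s : S₁) →
    Term F₁ (X := Σ t : S₂, Σ s' : S₁, P s t × Q t s') (fun x => x.2.1) s

/-- The equations given by `T : LinkTerms F₁ F₂ P Q` hold for actions of `P` and `Q`. -/
structure IsLink {P : S₁ → S₂ → Type u} {Q : S₂ → S₁ → Type u} (T : LinkTerms F₁ F₂ P Q)
    {C : Algebra F₁} {D : Algebra F₂} (α : Action P C D) (β : Action Q D C) : Prop where
  map_op : ∀ (f : F₁.Op) (t : S₂) (p : P (F₁.cod f) t)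
    (a : (i : F₁.Ar f) → C.carrier (F₁.dom f i)),
    α _ t p (C.op f a) = (T.opT f t p).eval D (fun x => α _ _ x.2.2 (a x.1))
  comp : ∀ (s : S₁) (t : S₂) (s' : S₁) (p : P s t) (q : Q t s') (a : C.carrier s),
    β t s' q (α s t p a) = (T.compT s t s' p q).eval C (fun _ => a)
  recover : ∀ (s : S₁) (a : C.carrier s),
    (T.recT s).eval C (fun x => β _ _ x.2.2.2 (α _ _ x.2.2.1 a)) = a

/-- A link between an `F₁`-algebra and an `F₂`-algebra. -/
structure Link {P : S₁ → S₂ → Type u} {Q : S₂ → S₁ → Type u} (T : LinkTerms F₁ F₂ P Q)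
    (T' : LinkTerms F₂ F₁ Q P) (C : Algebra F₁) (D : Algebra F₂) where
  fwd : Action P C D
  bwd : Action Q D C
  isLink : IsLink T fwd bwd
  isLink' : IsLink T' bwd fwd

/-- The actions satisfy equations of the form `IsLink`. -/
structure IsLinkable {P : S₁ → S₂ → Type u} {Q : S₂ → S₁ → Type u} {C : Algebra F₁}
    {D : Algebra F₂} (α : Action P C D) (β : Action Q D C) : Prop where
  map_op : ∀ (f : F₁.Op) (t : S₂) (p : P (F₁.cod f) t),
    ∃ U : Term F₂ (X := Σ i : F₁.Ar f, Σ t' : S₂, P (F₁.dom f i) t') (fun x => x.2.1) t,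
      ∀ a : (i : F₁.Ar f) → C.carrier (F₁.dom f i),
        α _ t p (C.op f a) = U.eval D (fun x => α _ _ x.2.2 (a x.1))
  comp : ∀ (s : S₁) (t : S₂) (s' : S₁) (p : P s t) (q : Q t s'),
    ∃ U : Term F₁ (X := PUnit.{u + 1}) (fun _ => s) s',
      ∀ a : C.carrier s, β t s' q (α s t p a) = U.eval C (fun _ => a)
  recover : ∀ s : S₁,
    ∃ U : Term F₁ (X := Σ t : S₂, Σ s' : S₁, P s t × Q t s') (fun x => x.2.1) s,
      ∀ a : C.carrier s, U.eval C (fun x => β _ _ x.2.2.2 (α _ _ x.2.2.1 a)) = a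

theorem IsLinkable.exists_isLink {P : S₁ → S₂ → Type u} {Q : S₂ → S₁ → Type u} {C : Algebra F₁}
    {D : Algebra F₂} {α : Action P C D} {β : Action Q D C} (h : IsLinkable α β) :
    ∃ T, IsLink T α β := by
  obtain ⟨h₁, h₂, h₃⟩ := h
  choose T₁ hT₁ using h₁
  choose T₂ hT₂ using h₂
  choose T₃ hT₃ using h₃
  exact ⟨⟨T₁, T₂, T₃⟩, hT₁, hT₂, hT₃⟩

/-- There is a link between `A` and `B`. -/
def Linked (A : Algebra F₁) (B : Algebra F₂) : Prop :=
  ∃ (P : S₁ → S₂ → Type u) (Q : S₂ → S₁ → Type u) (T : LinkTerms F₁ F₂ P Q)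
    (T' : LinkTerms F₂ F₁ Q P), Nonempty (Link T T' A B)

theorem IsLinkable.linked {P : S₁ → S₂ → Type u} {Q : S₂ → S₁ → Type u} {C : Algebra F₁}
    {D : Algebra F₂} {α : Action P C D} {β : Action Q D C} (h : IsLinkable α β)
    (h' : IsLinkable β α) : Linked C D :=
  let ⟨T, hT⟩ := h.exists_isLink
  let ⟨T', hT'⟩ := h'.exists_isLink
  ⟨P, Q, T, T', ⟨α, β, hT, hT'⟩⟩

/-! ### Homomorphisms along links -/

namespace Link

variable {P : S₁ → S₂ → Type u} {Q : S₂ → S₁ → Type u} {T : LinkTerms F₁ F₂ P Q}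
  {T' : LinkTerms F₂ F₁ Q P} {C C' C'' : Algebra F₁} {D D' D'' : Algebra F₂}

/-- The inverse link. -/
def symm (L : Link T T' C D) : Link T' T D C := ⟨L.bwd, L.fwd, L.isLink', L.isLink⟩

/-- By `recover`, `y` is a fixed term in elements `p (q y)`, so the maps `q` are jointly injective.
-/
theorem ext_bwd (L : Link T T' C D) {t : S₂} {y z : D.carrier t}
    (h : ∀ s (q : Q t s), L.bwd t s q y = L.bwd t s q z) : y = z := by
  rw [← L.isLink'.recover t y, ← L.isLink'.recover t z]
  simp only [h]

/-- `g` corresponds to `h` under the links `L` and `L'`. -/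
def Rel (L : Link T T' C D) (L' : Link T T' C' D') (h : Hom C C') (g : Hom D D') : Prop :=
  ∀ t s (q : Q t s) (y : D.carrier t), L'.bwd t s q (g.toFun t y) = h.toFun s (L.bwd t s q y)

theorem Rel.symm {L : Link T T' C D} {L' : Link T T' C' D'} {h : Hom C C'} {g : Hom D D'}
    (H : L.Rel L' h g) : L.symm.Rel L'.symm g h := by
  intro s t p x
  refine L'.ext_bwd fun s' q => ?_
  change L'.bwd t s' q (L'.fwd s t p _) = L'.bwd t s' q (g.toFun t (L.fwd s t p x))
  rw [H, L.isLink.comp, L'.isLink.comp, h.map_eval]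

theorem Rel.unique {L : Link T T' C D} {L' : Link T T' C' D'} {h : Hom C C'} {g g' : Hom D D'}
    (H : L.Rel L' h g) (H' : L.Rel L' h g') : g = g' :=
  Hom.ext (funext fun t => funext fun y => L'.ext_bwd fun s q => by rw [H, H'])

/-- The elements `y` with a matching `z` are closed under operations by `map_op` and include every
`p (q y)`, matched by `p (h (q y))`. By `recover` these generate all `y`. Joint injectivity of the
`q` makes the resulting map a homomorphism. -/
theorem exists_rel (L : Link T T' C D) (L' : Link T T' C' D') (h : Hom C C') :
    ∃ g, L.Rel L' h g := by
  have key : ∀ t (y : D.carrier t), ∃ z : D'.carrier t,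
      ∀ s (q : Q t s), L'.bwd t s q z = h.toFun s (L.bwd t s q y) := by
    intro t y
    rw [← L.isLink'.recover t y]
    refine Term.eval_mem (A := D) (r := fun t => {y | ∃ z : D'.carrier t,
      ∀ s (q : Q t s), L'.bwd t s q z = h.toFun s (L.bwd t s q y)}) ?_ _ _ ?_
    · intro f a ha
      choose z hz using ha
      refine ⟨D'.op f z, fun s q => ?_⟩
      rw [L.isLink'.map_op, L'.isLink'.map_op, h.map_eval]
      simp only [hz]
    · intro x
      refine ⟨L'.fwd _ _ x.2.2.2 (h.toFun _ (L.bwd _ _ x.2.2.1 y)), fun s q => ?_⟩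
      rw [L.isLink.comp, L'.isLink.comp, h.map_eval]
  choose g hg using key
  refine ⟨⟨g, fun f a => L'.ext_bwd fun s q => ?_⟩, fun t s q y => hg t y s q⟩
  rw [hg, L.isLink'.map_op, L'.isLink'.map_op, h.map_eval]
  simp only [hg]

/-! ### Transport of an algebra along a link -/

section Transport

variable {A : Algebra F₁} {B : Algebra F₂} (L : Link T T' A B) (hC : variety A C)

/-- The set of those elements of the power of `B` that are sent by `Q` into the free `A`-algebra
over the set `C`. -/
def lattice (L : Link T T' A B) (C : Algebra F₁) (t : S₂) :
    Set (((x : Σ s, C.carrier s) → A.carrier x.1) → B.carrier t) :=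
  {y | ∀ s (q : Q t s), (fun m => L.bwd t s q (y m)) ∈ Clo A Sigma.fst s}

/-- The algebra `lattice L C`. -/
def latticeAlg (L : Link T T' A B) (C : Algebra F₁) : Algebra F₂ where
  carrier t := L.lattice C t
  op f y := ⟨fun m => B.op f fun i => (y i).1 m, by
    intro s q
    simp only [L.isLink'.map_op]
    exact Clo.eval_mem A (v := Sigma.fst) (T'.opT f s q)
      (fun x m => L.bwd _ _ x.2.2 ((y x.1).1 m)) fun x => (y x.1).2 _ x.2.2⟩

theorem latticeAlg_val_eval {Y : Type u} {w : Y → S₂} {t : S₂} (U : Term F₂ w t)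
    (y : (x : Y) → (L.latticeAlg C).carrier (w x)) (m : (x : Σ s, C.carrier s) → A.carrier x.1) :
    (U.eval (L.latticeAlg C) y).1 m = U.eval B (fun x => (y x).1 m) := by
  induction U with
  | var x => rfl
  | app f U ih => simp only [Term.eval, ← ih]; rfl

/-- The link between the free `A`-algebra over the set `C` and `lattice L C`. -/
def freeLink (L : Link T T' A B) (C : Algebra F₁) :
    Link T T' (Free A (Sigma.fst : (Σ s, C.carrier s) → S₁)) (L.latticeAlg C) where
  fwd s t p g := ⟨fun m => L.fwd s t p (g.1 m), by
    intro s' q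
    simp only [L.isLink.comp]
    exact Clo.eval_mem A (v := Sigma.fst) (T.compT s t s' p q) (fun _ => g.1) fun _ => g.2⟩
  bwd t s q y := ⟨fun m => L.bwd t s q (y.1 m), y.2 s q⟩
  isLink :=
    { map_op := fun f t p a => Subtype.ext <| funext fun m => by
        refine Eq.trans ?_ (L.latticeAlg_val_eval _ _ m).symm
        exact L.isLink.map_op f t p _
      comp := fun s t s' p q a => Subtype.ext <| funext fun m =>
        (L.isLink.comp s t s' p q _).trans (Free.val_eval _ _ m).symm
      recover := fun s a => Subtype.ext <| funext fun m =>
        (Free.val_eval _ _ m).trans (L.isLink.recover s _) }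
  isLink' :=
    { map_op := fun f t p a => Subtype.ext <| funext fun m => by
        refine Eq.trans ?_ (Free.val_eval _ _ m).symm
        exact L.isLink'.map_op f t p _
      comp := fun s t s' p q a => Subtype.ext <| funext fun m =>
        (L.isLink'.comp s t s' p q _).trans (L.latticeAlg_val_eval _ _ m).symm
      recover := fun s a => Subtype.ext <| funext fun m =>
        (L.latticeAlg_val_eval _ _ m).trans (L.isLink'.recover s _) }

/-- The canonical homomorphism from the free algebra over the set `C` to `C`. -/
noncomputable def counit : Hom (Free A (Sigma.fst : (Σ s, C.carrier s) → S₁)) C :=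
  Free.lift hC fun x => x.2

theorem counit_surjective (s : S₁) (c : C.carrier s) :
    ∃ g, (counit hC).toFun s g = c :=
  ⟨Free.gen A (Sigma.fst : (Σ s, C.carrier s) → S₁) ⟨s, c⟩,
    Free.lift_gen (v := (Sigma.fst : (Σ s, C.carrier s) → S₁)) hC (fun x => x.2) ⟨s, c⟩⟩

/-- The action of `Q` from `lattice L C` to `C`. -/
noncomputable def latticeBwd (t : S₂) (y : (L.latticeAlg C).carrier t) (s : S₁) (q : Q t s) :
    C.carrier s :=
  (counit hC).toFun s ((L.freeLink C).bwd t s q y)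

theorem latticeBwd_op (f : F₂.Op) (y : (i : F₂.Ar f) → (L.latticeAlg C).carrier (F₂.dom f i)) :
    L.latticeBwd hC _ ((L.latticeAlg C).op f y) = fun s q =>
      (T'.opT f s q).eval C fun x => L.latticeBwd hC _ (y x.1) _ x.2.2 := by
  funext s q
  unfold latticeBwd
  rw [(L.freeLink C).isLink'.map_op, Hom.map_eval]

theorem latticeBwd_fwd {s : S₁} {t : S₂} (p : P s t)
    (g : (Free A (Sigma.fst : (Σ s, C.carrier s) → S₁)).carrier s) :
    L.latticeBwd hC t ((L.freeLink C).fwd s t p g) = fun s' q =>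
      (T.compT s t s' p q).eval C fun _ => (counit hC).toFun s g := by
  funext s' q
  unfold latticeBwd
  rw [(L.freeLink C).isLink.comp, Hom.map_eval]

/-- The transport of an algebra `C` in the variety of `A` along a link from `A` to `B`. -/
noncomputable def transport : Algebra F₂ where
  -- An element of an algebra linked to `C` is determined by its images under all `q`; it is
  -- therefore modelled as this tuple of images, and `map_op` dictates the operations.
  carrier t := Set.range (L.latticeBwd hC t)
  op f k := ⟨fun s q => (T'.opT f s q).eval C fun x => (k x.1).1 _ x.2.2, by
    choose y hy using fun i => (k i).2
    refine ⟨(L.latticeAlg C).op f y, (L.latticeBwd_op hC f y).trans ?_⟩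
    simp only [hy]⟩

/-- The quotient map from `lattice L C` to the transport of `C`. -/
noncomputable def transportMk : Hom (L.latticeAlg C) (L.transport hC) where
  toFun t y := ⟨L.latticeBwd hC t y, y, rfl⟩
  map_op f y := Subtype.ext (L.latticeBwd_op hC f y)

theorem transportMk_surjective (t : S₂) (k : (L.transport hC).carrier t) :
    ∃ y, (L.transportMk hC).toFun t y = k :=
  let ⟨_, y, hy⟩ := k
  ⟨y, Subtype.ext hy⟩

/-- The transport is a quotient of `lattice L C`, a subalgebra of a power of `B`. -/
theorem transport_mem_variety : variety B (L.transport hC) := by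
  intro Y w t U₁ U₂ h
  funext k
  choose y hy using fun x => L.transportMk_surjective hC _ (k x)
  obtain rfl := funext hy
  rw [← Hom.map_eval, ← Hom.map_eval]
  congr 1
  refine Subtype.ext (funext fun m => ?_)
  rw [latticeAlg_val_eval, latticeAlg_val_eval, h]

/-- The action of `P` from `C` to its transport. -/
noncomputable def transportFwd : Action P C (L.transport hC) := fun s t p c =>
  ⟨fun s' q => (T.compT s t s' p q).eval C fun _ => c, by
    obtain ⟨g, rfl⟩ := counit_surjective hC s c
    exact ⟨_, L.latticeBwd_fwd hC p g⟩⟩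

/-- The action of `Q` from the transport of `C` to `C`. -/
def transportBwd : Action Q (L.transport hC) C := fun _ s q k => k.1 s q

/-- The actions on `C` and its transport are induced from `freeLink` through the two quotient maps,
so the equations of `freeLink` descend. -/
theorem transportFwd_counit {s : S₁} {t : S₂} (p : P s t)
    (g : (Free A (Sigma.fst : (Σ s, C.carrier s) → S₁)).carrier s) :
    L.transportFwd hC s t p ((counit hC).toFun s g) =
      (L.transportMk hC).toFun t ((L.freeLink C).fwd s t p g) :=
  Subtype.ext (L.latticeBwd_fwd hC p g).symm

theorem transportBwd_mk {s : S₁} {t : S₂} (q : Q t s) (y : (L.latticeAlg C).carrier t) :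
    L.transportBwd hC t s q ((L.transportMk hC).toFun t y) =
      (counit hC).toFun s ((L.freeLink C).bwd t s q y) :=
  rfl

/-- An algebra in the variety of `A` is linked to its transport. -/
noncomputable def toTransport : Link T T' C (L.transport hC) where
  fwd := L.transportFwd hC
  bwd := L.transportBwd hC
  isLink :=
    { map_op := by
        intro f t p a
        choose g hg using fun i => counit_surjective hC _ (a i)
        obtain rfl : (fun i => (counit hC).toFun _ (g i)) = a := funext hg
        rw [← Hom.map_op, transportFwd_counit, (L.freeLink C).isLink.map_op, Hom.map_eval]
        simp only [transportFwd_counit]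
      comp := fun _ _ _ _ _ _ => rfl
      recover := by
        intro s a
        obtain ⟨g, rfl⟩ := counit_surjective hC _ a
        simp only [transportFwd_counit, transportBwd_mk]
        rw [← Hom.map_eval, (L.freeLink C).isLink.recover] }
  isLink' :=
    { map_op := fun _ _ _ _ => rfl
      comp := by
        intro t s t' q p k
        obtain ⟨y, rfl⟩ := L.transportMk_surjective hC t k
        rw [transportBwd_mk, transportFwd_counit, (L.freeLink C).isLink'.comp, Hom.map_eval]
      recover := by
        intro t k
        obtain ⟨y, rfl⟩ := L.transportMk_surjective hC t k
        simp only [transportFwd_counit, transportBwd_mk]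
        rw [← Hom.map_eval, (L.freeLink C).isLink'.recover] }

end Transport

/-! ### The equivalence of varieties given by a link -/

section Equivalence

variable {A : Algebra F₁} {B : Algebra F₂} (L : Link T T' A B)

/-- The functor between varieties that sends every algebra to its transport. -/
noncomputable def functor : VarietyCat A ⥤ VarietyCat B where
  obj C := ⟨L.transport C.property, L.transport_mem_variety C.property⟩
  map {C C'} h := ObjectProperty.homMk
    ((L.toTransport C.property).exists_rel (L.toTransport C'.property) h.hom).choose
  map_id C := ObjectProperty.hom_ext _
    (Rel.unique (((L.toTransport C.property).exists_rel (L.toTransport C.property) _).choose_spec)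
      (fun _ _ _ _ => rfl))
  map_comp {C C' C''} h h' := ObjectProperty.hom_ext _
    (Rel.unique (((L.toTransport C.property).exists_rel (L.toTransport C''.property) _).choose_spec)
      (fun t s q y => by
        have H := ((L.toTransport C.property).exists_rel
          (L.toTransport C'.property) h.hom).choose_spec
        have H' := ((L.toTransport C'.property).exists_rel
          (L.toTransport C''.property) h'.hom).choose_spec
        exact (H' t s q _).trans (congrArg (Hom.toFun h'.hom s) (H t s q y))))

theorem functor_map_rel {C C' : VarietyCat A} (h : C ⟶ C') :
    (L.toTransport C.property).Rel (L.toTransport C'.property) h.hom (L.functor.map h).hom :=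
  ((L.toTransport C.property).exists_rel (L.toTransport C'.property) h.hom).choose_spec

/-- Algebras linked to the same algebra are isomorphic. -/
theorem nonempty_iso {C : Algebra F₁} {D D' : VarietyCat B} (K : Link T T' C D.obj)
    (K' : Link T T' C D'.obj) : Nonempty (D ≅ D') := by
  obtain ⟨g, hg⟩ := K.exists_rel K' (𝟙 C)
  obtain ⟨g', hg'⟩ := K'.exists_rel K (𝟙 C)
  refine ⟨⟨ObjectProperty.homMk g, ObjectProperty.homMk g',
    ObjectProperty.hom_ext _ (Rel.unique (L := K) (L' := K) (h := 𝟙 C) ?_ fun _ _ _ _ => rfl),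
    ObjectProperty.hom_ext _ (Rel.unique (L := K') (L' := K') (h := 𝟙 C) ?_ fun _ _ _ _ => rfl)⟩⟩
  · exact fun t s q y => (hg' t s q _).trans (hg t s q y)
  · exact fun t s q y => (hg t s q _).trans (hg' t s q y)

/-- Faithfulness and fullness are uniqueness and existence of the corresponding homomorphism along
the inverse links. For essential surjectivity, `D` and the transport of its transport back are
linked to the same algebra. -/
theorem isEquivalence_functor : L.functor.IsEquivalence where
  faithful := ⟨fun {C C'} h h' e => ObjectProperty.hom_ext _
    ((L.functor_map_rel h).symm.unique (e ▸ (L.functor_map_rel h').symm))⟩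
  full := ⟨fun {C C'} g => by
    obtain ⟨h, hh⟩ :=
      (L.toTransport C.property).symm.exists_rel (L.toTransport C'.property).symm g.hom
    exact ⟨ObjectProperty.homMk h, ObjectProperty.hom_ext _
      ((L.functor_map_rel _).unique hh.symm)⟩⟩
  essSurj := ⟨fun D => ⟨⟨L.symm.transport D.property, L.symm.transport_mem_variety D.property⟩,
    nonempty_iso (L.toTransport _) (L.symm.toTransport D.property).symm⟩⟩

theorem exists_equivalence (L : Link T T' A B) : ∃ E : VarietyCat A ≌ VarietyCat B,
    Nonempty (E.functor.obj (VarietyCat.gen A) ≅ VarietyCat.gen B) :=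
  have := L.isEquivalence_functor
  ⟨L.functor.asEquivalence, nonempty_iso (L.toTransport (VarietyCat.gen A).property) L⟩

end Equivalence

end Link

/-! ### Invariant sets as subalgebras of powers -/

/-- A subalgebra of the power `A ^ μ`, given by its carrier sets. -/
@[ext]
structure ClosedRel (A : Algebra F) (μ : Type u) where
  rel : (s : S) → Set (μ → A.carrier s)
  op_mem : ∀ (f : F.Op) (a : (i : F.Ar f) → μ → A.carrier (F.dom f i)),
    (∀ i, a i ∈ rel (F.dom f i)) → (fun j => A.op f fun i => a i j) ∈ rel (F.cod f)

namespace ClosedRel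

variable {A : Algebra F} {B : Algebra F₂} {μ μ' : Type u}

instance : PartialOrder (ClosedRel A μ) :=
  PartialOrder.lift ClosedRel.rel fun _ _ => ClosedRel.ext

theorem eval_mem (R : ClosedRel A μ) {X : Type u} {v : X → S} {s : S} (t : Term F v s)
    (a : (x : X) → μ → A.carrier (v x)) (ha : ∀ x, a x ∈ R.rel (v x)) :
    (fun j => t.eval A fun x => a x j) ∈ R.rel s := by
  have := Term.eval_mem (A := A.pow μ) R.op_mem t a ha
  rwa [Term.eval_pow] at this

/-- The product of the carrier sets of a subalgebra. -/
def toSet (R : ClosedRel A μ) : Set (μ → A.Total) :=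
  {a | ∀ s, (fun j => a j s) ∈ R.rel s}

theorem toSet_mem_Inv (κ : Cardinal.{u}) (R : ClosedRel A μ) : R.toSet ∈ Inv κ A μ := by
  intro L _ f hf a ha s
  obtain ⟨t, ht⟩ := hf s
  simp only [← ht]
  exact R.eval_mem t (fun p j => a p.1 j p.2) fun p => ha p.1 p.2

/-- The sorted version of `ppDef`. -/
def pp {ν U : Type u} {I : U → Type u} (f : (c : U) → I c → μ ⊕ ν)
    (R : (c : U) → ClosedRel A (I c)) : ClosedRel A μ where
  rel s := ppDef f fun c => (R c).rel s
  op_mem g a ha := by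
    choose b hb using ha
    refine ⟨fun j => A.op g fun i => b i j, fun c => ?_⟩
    convert (R c).op_mem g _ fun i => hb i c using 2 with j
    rcases f c j with k | k <;> rfl

/-- A witness in the total product is an independent choice of witnesses, one for each sort. -/
theorem toSet_pp {ν U : Type u} {I : U → Type u} (f : (c : U) → I c → μ ⊕ ν)
    (R : (c : U) → ClosedRel A (I c)) : (pp f R).toSet = ppDef f fun c => (R c).toSet := by
  ext a
  constructor
  · intro h
    choose b hb using h
    refine ⟨fun j s => b s j, fun c s => ?_⟩
    convert hb s c using 2 with j
    dsimp only
    rcases f c j with k | k <;> rfl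
  · rintro ⟨b, hb⟩ s
    refine ⟨fun j => b j s, fun c => ?_⟩
    convert hb c s using 2 with j
    dsimp only
    rcases f c j with k | k <;> rfl

/-- Term operations from every sort to every other sort. -/
theorem exists_unary (hA : HasPureClone A) : ∃ U : (s t : S) → A.carrier s → A.carrier t,
    ∀ s t (X : Type u) (v : X → S) (g : ((x : X) → A.carrier (v x)) → A.carrier s),
      g ∈ Clo A v s → (fun a => U s t (g a)) ∈ Clo A v t := by
  choose U hU using hA
  refine ⟨fun s t a => U s t fun _ => a, fun s t X v g hg => ?_⟩
  obtain ⟨t', ht'⟩ := hU s t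
  beta_reduce
  rw [← ht']
  exact Clo.eval_mem A t' (fun _ => g) fun _ => hg

open Classical in
/-- Inserting an operation into a family of operations, one for each sort. -/
theorem exists_family (hA : HasPureClone A) {X : Type u} {v : X → S} {s : S}
    {g : ((x : X) → A.carrier (v x)) → A.carrier s} (hg : g ∈ Clo A v s) :
    ∃ f : (t : S) → ((x : X) → A.carrier (v x)) → A.carrier t,
      f s = g ∧ ∀ t, f t ∈ Clo A v t := by
  obtain ⟨U, hU⟩ := exists_unary hA
  -- The term operation `U s s` need not be the identity, so the component of sort `s` is replaced
  -- by `g` itself.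
  refine ⟨Function.update (fun t a => U s t (g a)) s g, by simp, fun t => ?_⟩
  by_cases h : t = s
  · subst h
    simpa using hg
  · simpa [h] using hU s t X v g hg

/-- Extending an element of a subalgebra to an element of the product of the carrier sets. -/
theorem exists_mem_toSet (hA : HasPureClone A) (R : ClosedRel A μ) {s : S}
    {x : μ → A.carrier s} (hx : x ∈ R.rel s) : ∃ a ∈ R.toSet, (fun j => a j s) = x := by
  obtain ⟨f, hf, hf'⟩ := exists_family hA (v := fun _ : PUnit.{u + 1} => s)
    (g := fun a => a PUnit.unit) ⟨.var PUnit.unit, rfl⟩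
  refine ⟨fun j t => f t fun _ => x j, fun t => ?_, by simp [hf]⟩
  obtain ⟨t', ht'⟩ := hf' t
  beta_reduce
  rw [← ht']
  exact R.eval_mem t' (fun _ => x) fun _ => hx

variable {κ : Cardinal.{u}}

/-- The subalgebra given by an invariant set. -/
def ofInv (hF : F.IsAry κ) (hA : HasPureClone A) (r : Inv κ A μ) : ClosedRel A μ where
  rel s := (fun a j => a j s) '' r.1
  op_mem g x hx := by
    choose a ha hax using hx
    -- Elements of `r` have components of all sorts, so `g` is read as an operation in the variables
    -- `Ar g × S` that ignores all but `(i, dom g i)`.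
    obtain ⟨f, hf, hf'⟩ := exists_family hA (v := fun p : F.Ar g × S => p.2) (s := F.cod g)
      (g := fun b => A.op g fun i => b (i, F.dom g i))
      (Clo.op_mem A g _ fun i => ⟨.var (i, F.dom g i), rfl⟩)
    refine ⟨_, r.2 _ (hF g) f hf' a ha, ?_⟩
    funext j
    simp only [hf]
    congr 1
    funext i
    exact congrFun (hax i) j

/-- Invariant sets correspond to subalgebras of powers. -/
def invEquiv [Nonempty S] (hS : #S < κ) (hF : F.IsAry κ) (hA : HasPureClone A) :
    ClosedRel A μ ≃ Inv κ A μ where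
  toFun R := ⟨R.toSet, R.toSet_mem_Inv κ⟩
  invFun r := ofInv hF hA r
  left_inv R := by
    refine ClosedRel.ext (funext fun s => Set.ext fun x => ⟨?_, fun hx => ?_⟩)
    · rintro ⟨a, ha, rfl⟩
      exact ha s
    · obtain ⟨a, ha, hax⟩ := R.exists_mem_toSet hA hx
      exact ⟨a, ha, hax⟩
  right_inv r := by
    refine Subtype.ext (Set.ext fun a => ⟨fun ha => ?_, fun ha s => ⟨a, ha, rfl⟩⟩)
    choose b hb hba using ha
    -- The diagonal projections take the component of sort `s` from `b s`; closure under this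
    -- family, with `L = S`, shows that `r` is the product of its projections to the sorts.
    have := r.2 S hS (fun s c => c (s, s)) (fun s => ⟨.var (s, s), rfl⟩) b hb
    convert this using 1
    funext j s
    exact (congrFun (hba s) j).symm

/-- The relation of equality. -/
def eqRel (A : Algebra F) : ClosedRel A (ULift.{u} Bool) where
  rel _ := {x | x ⟨true⟩ = x ⟨false⟩}
  op_mem f _ ha := congrArg (A.op f) (funext ha)

/-- The image of a relation under a change of coordinates. -/
def reindex (g : μ → μ') (R : ClosedRel A μ') : ClosedRel A μ where
  rel s := (fun y j => y (g j)) '' R.rel s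
  op_mem f a ha := by
    choose b hb hba using ha
    obtain rfl := funext hba
    exact ⟨_, R.op_mem f b hb, rfl⟩

/-- The relation of all term operations. -/
def clo (A : Algebra F) {X : Type u} (v : X → S) : ClosedRel A ((x : X) → A.carrier (v x)) where
  rel s := Clo A v s
  op_mem f a ha := Clo.op_mem A f a ha

/-- The projections generate the algebra of term operations. -/
theorem clo_le {X : Type u} {v : X → S} {R : ClosedRel A ((x : X) → A.carrier (v x))}
    (h : ∀ x, (fun a => a x) ∈ R.rel (v x)) : clo A v ≤ R := by
  rintro s _ ⟨t, rfl⟩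
  exact R.eval_mem t _ h

/-- The relation generated by a family of elements. -/
def span {X : Type u} {v : X → S} (w : (x : X) → μ → A.carrier (v x)) : ClosedRel A μ where
  rel s := Set.range fun t : Term F v s => fun j => t.eval A fun x => w x j
  op_mem f a ha := by
    choose t ht using ha
    obtain rfl := funext ht
    exact ⟨.app f t, rfl⟩

theorem mem_span {X : Type u} {v : X → S} (w : (x : X) → μ → A.carrier (v x)) (x : X) :
    w x ∈ (span w).rel (v x) :=
  ⟨.var x, rfl⟩

theorem reindex_le {g : μ → μ'} {R : ClosedRel A μ'} {R' : ClosedRel A μ}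
    (h : ∀ s, ∀ x ∈ R.rel s, (fun j => x (g j)) ∈ R'.rel s) : reindex g R ≤ R' := by
  rintro s _ ⟨x, hx, rfl⟩
  exact h s x hx

end ClosedRel

/-! ### Transport of relations along a link -/

section LinkToIso

variable {P : S₁ → S₂ → Type u} {Q : S₂ → S₁ → Type u} {T : LinkTerms F₁ F₂ P Q}
  {T' : LinkTerms F₂ F₁ Q P} {A : Algebra F₁} {B : Algebra F₂} {μ : Type u}

/-- The transport of relations along a link. -/
def Link.mapRel (L : Link T T' A B) (R : ClosedRel A μ) : ClosedRel B μ where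
  rel t := {y | ∀ s (q : Q t s), (fun j => L.bwd t s q (y j)) ∈ R.rel s}
  op_mem f a ha s q := by
    simp only [L.isLink'.map_op]
    exact R.eval_mem (T'.opT f s q) (fun x j => L.bwd _ _ x.2.2 (a x.1 j)) fun x => ha x.1 _ x.2.2

/-- One inclusion rebuilds `x` from the tuples `q (p x)` by `recover`; the other holds since `q ∘ p`
is a term operation. -/
theorem Link.mapRel_mapRel (L : Link T T' A B) (R : ClosedRel A μ) :
    L.symm.mapRel (L.mapRel R) = R := by
  refine ClosedRel.ext (funext fun s => Set.ext fun x => ⟨fun h => ?_, fun h t p s' q => ?_⟩)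
  · have := R.eval_mem (T.recT s) (fun y j => L.bwd _ _ y.2.2.2 (L.fwd _ _ y.2.2.1 (x j)))
      fun y => h _ y.2.2.1 _ y.2.2.2
    simpa only [L.isLink.recover] using this
  · change (fun j => L.bwd t s' q (L.fwd s t p (x j))) ∈ R.rel s'
    simp only [L.isLink.comp]
    exact R.eval_mem (T.compT s t s' p q) (fun _ => x) fun _ => h

theorem Link.fwd_mem_mapRel (L : Link T T' A B) (R : ClosedRel A μ) {s : S₁} {t : S₂} (p : P s t)
    {x : μ → A.carrier s} (hx : x ∈ R.rel s) :
    (fun j => L.fwd s t p (x j)) ∈ (L.mapRel R).rel t := by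
  rw [← L.mapRel_mapRel R] at hx
  exact hx t p

/-- Each tuple `q y` has its own witness in `A`. Mapping these to `B` by all `p` and combining them
with the `recover` term gives one witness for `y`, because the same term returns `y` on the free
coordinates. -/
theorem Link.mapRel_pp (L : Link T T' A B) {ν U : Type u} {I : U → Type u}
    (f : (c : U) → I c → μ ⊕ ν) (R : (c : U) → ClosedRel A (I c)) :
    L.mapRel (ClosedRel.pp f R) = ClosedRel.pp f fun c => L.mapRel (R c) := by
  refine ClosedRel.ext (funext fun t => Set.ext fun y => ⟨fun h => ?_, ?_⟩)
  · choose b hb using h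
    refine ⟨fun j => (T'.recT t).eval B fun x => L.fwd _ _ x.2.2.2 (b _ x.2.2.1 j), fun c => ?_⟩
    convert (L.mapRel (R c)).eval_mem (T'.recT t) _
      fun x => L.fwd_mem_mapRel (R c) x.2.2.2 (hb _ x.2.2.1 c) using 2 with j
    rcases f c j with k | k
    · exact (L.isLink'.recover t (y k)).symm
    · rfl
  · rintro ⟨b, hb⟩ s q
    refine ⟨fun j => L.bwd t s q (b j), fun c => ?_⟩
    convert hb c s q using 2 with j
    dsimp only
    rcases f c j with k | k <;> rfl

end LinkToIso

/-! ### Isomorphisms of clones of sorted relations -/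

/-- An isomorphism of clones of sorted relations of arity less than `κ'`. -/
structure ClosedRelIso (κ' : Cardinal.{u}) (A : Algebra F₁) (B : Algebra F₂) where
  toFun : (μ : Type u) → #μ < κ' → ClosedRel A μ → ClosedRel B μ
  invFun : (μ : Type u) → #μ < κ' → ClosedRel B μ → ClosedRel A μ
  left_inv : ∀ μ hμ R, invFun μ hμ (toFun μ hμ R) = R
  right_inv : ∀ μ hμ R, toFun μ hμ (invFun μ hμ R) = R
  map_pp : ∀ (μ ν U : Type u) (I : U → Type u) (hμ : #μ < κ') (hI : ∀ c, #(I c) < κ')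
    (f : (c : U) → I c → μ ⊕ ν) (R : (c : U) → ClosedRel A (I c)),
    toFun μ hμ (ClosedRel.pp f R) = ClosedRel.pp f fun c => toFun (I c) (hI c) (R c)

namespace ClosedRelIso

open ClosedRel

variable {κ' : Cardinal.{u}} {A : Algebra F₁} {B : Algebra F₂} {μ μ' : Type u}

/-- The inverse isomorphism. -/
def symm (e : ClosedRelIso κ' A B) : ClosedRelIso κ' B A where
  toFun := e.invFun
  invFun := e.toFun
  left_inv := e.right_inv
  right_inv := e.left_inv
  map_pp μ ν U I hμ hI f R := by
    have := e.map_pp μ ν U I hμ hI f fun c => e.invFun _ (hI c) (R c)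
    simp only [e.right_inv] at this
    rw [← this, e.left_inv]

/-- `R ≤ R'` means `R ∩ R' = R`, and intersection is primitive positive. -/
theorem mono (e : ClosedRelIso κ' A B) (hμ : #μ < κ') {R R' : ClosedRel A μ} (h : R ≤ R') :
    e.toFun μ hμ R ≤ e.toFun μ hμ R' := by
  have H := e.map_pp μ PEmpty (ULift Bool) (fun _ => μ) hμ (fun _ => hμ) (fun _ => Sum.inl)
    (fun b => bif b.down then R else R')
  have hR : pp (ν := PEmpty) (fun _ => Sum.inl)
      (fun b : ULift.{u} Bool => bif b.down then R else R') = R := by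
    refine ClosedRel.ext (funext fun s => Set.ext fun x => ⟨?_, fun hx => ?_⟩)
    · rintro ⟨_, hb⟩
      exact hb ⟨true⟩
    · exact ⟨PEmpty.elim, fun b => by
        rcases b with ⟨_ | _⟩
        · exact h s hx
        · exact hx⟩
  rw [hR] at H
  rw [H]
  rintro s x ⟨_, hb⟩
  exact hb ⟨false⟩

theorem le_iff (e : ClosedRelIso κ' A B) (hμ : #μ < κ') {R : ClosedRel A μ} {R' : ClosedRel B μ} :
    e.toFun μ hμ R ≤ R' ↔ R ≤ e.invFun μ hμ R' :=
  ⟨fun h => by simpa only [symm, e.left_inv] using e.symm.mono hμ h,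
    fun h => by simpa only [e.right_inv] using e.mono hμ h⟩

theorem two_lt (hκ' : ℵ₀ ≤ κ') : #(ULift.{u} Bool) < κ' :=
  (Cardinal.lt_aleph0_of_finite _).trans_le hκ'

/-- Equality is the unit of the composition of relations, hence preserved. -/
theorem map_eqRel (e : ClosedRelIso κ' A B) (hκ' : ℵ₀ ≤ κ') :
    e.toFun _ (two_lt hκ') (eqRel A) = eqRel B := by
  -- This encodes composition of binary relations: the constraint indexed by `true` relates `x true`
  -- to the bound variable, the one indexed by `false` relates the latter to `x false`.
  let g : ULift.{u} Bool → ULift.{u} Bool → ULift.{u} Bool ⊕ PUnit.{u + 1} := fun c j =>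
    match c.down, j.down with
    | true, true => Sum.inl ⟨true⟩
    | true, false => Sum.inr PUnit.unit
    | false, true => Sum.inr PUnit.unit
    | false, false => Sum.inl ⟨false⟩
  have H := e.map_pp _ _ _ (fun _ : ULift.{u} Bool => ULift.{u} Bool) (two_lt hκ')
    (fun _ => two_lt hκ') g
    (fun c => bif c.down then eqRel A else e.invFun _ (two_lt hκ') (eqRel B))
  have h₁ : pp g (fun c => bif c.down then eqRel A else e.invFun _ (two_lt hκ') (eqRel B)) =
      e.invFun _ (two_lt hκ') (eqRel B) := by
    generalize e.invFun _ (two_lt hκ') (eqRel B) = R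
    refine ClosedRel.ext (funext fun s => Set.ext fun x => ⟨?_, fun hx => ?_⟩)
    · rintro ⟨b, hb⟩
      have h : x ⟨true⟩ = b PUnit.unit := hb ⟨true⟩
      have h' : (fun j => Sum.elim x b (g ⟨false⟩ j)) ∈ R.rel s := hb ⟨false⟩
      convert h' using 1
      funext j
      rcases j with ⟨_ | _⟩
      · rfl
      · exact h
    · refine ⟨fun _ => x ⟨true⟩, fun c => ?_⟩
      rcases c with ⟨_ | _⟩
      · change (fun j => Sum.elim x (fun _ => x ⟨true⟩) (g ⟨false⟩ j)) ∈ R.rel s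
        convert hx using 1
        funext j
        rcases j with ⟨_ | _⟩ <;> rfl
      · rfl
  -- Now `eqRel B` is the composite of the image of `eqRel A` with `eqRel B`, which is the image of
  -- `eqRel A`.
  rw [h₁, e.right_inv] at H
  refine ClosedRel.ext (funext fun s => Set.ext fun x => ?_)
  rw [H]
  constructor
  · intro hx
    refine ⟨fun _ => x ⟨false⟩, fun c => ?_⟩
    rcases c with ⟨_ | _⟩
    · change (fun j => _) ∈ (e.toFun _ _ (e.invFun _ _ (eqRel B))).rel s
      rw [e.right_inv]
      rfl
    · change (fun j => _) ∈ (e.toFun _ _ (eqRel A)).rel s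
      convert hx using 1
      funext j
      rcases j with ⟨_ | _⟩ <;> rfl
  · rintro ⟨b, hb⟩
    have h : (fun j => Sum.elim x b (g ⟨false⟩ j)) ∈
        (e.toFun _ _ (e.invFun _ _ (eqRel B))).rel s := hb ⟨false⟩
    rw [e.right_inv] at h
    replace h : b PUnit.unit = x ⟨false⟩ := h
    have h' : (fun j => Sum.elim x b (g ⟨true⟩ j)) ∈ (e.toFun _ _ (eqRel A)).rel s := hb ⟨true⟩
    convert h' using 1
    funext j
    rcases j with ⟨_ | _⟩
    · exact h.symm
    · rfl

/-- The primitive positive definition of `reindex`. -/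
theorem reindex_eq_pp (A : Algebra F) (g : μ → μ') (R : ClosedRel A μ') :
    reindex g R = pp (ν := μ') (I := fun c : Option μ => Option.elim c μ' fun _ => ULift.{u} Bool)
      (fun c => match c with
        | none => Sum.inr
        | some j => fun b => if b.down then Sum.inl j else Sum.inr (g j))
      (fun c => match c with
        | none => R
        | some _ => eqRel A) := by
  refine ClosedRel.ext (funext fun s => Set.ext fun x => ⟨?_, ?_⟩)
  · rintro ⟨y, hy, rfl⟩
    refine ⟨y, fun c => ?_⟩
    rcases c with _ | j
    · exact hy
    · rfl
  · rintro ⟨y, hy⟩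
    exact ⟨y, hy none, funext fun j => (hy (some j) : x j = y (g j)).symm⟩

theorem map_reindex (e : ClosedRelIso κ' A B) (hκ' : ℵ₀ ≤ κ') (hμ : #μ < κ') (hμ' : #μ' < κ')
    (g : μ → μ') (R : ClosedRel A μ') :
    e.toFun μ hμ (reindex g R) = reindex g (e.toFun μ' hμ' R) := by
  rw [reindex_eq_pp, reindex_eq_pp, e.map_pp _ _ _ _ hμ
    (fun c => match c with
      | none => hμ'
      | some _ => two_lt hκ')]
  congr 1
  funext c
  rcases c with _ | j
  · rfl
  · exact e.map_eqRel hκ'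

/-! ### From relational clones to links -/

section ToLink

variable (hA : ∀ s, #(PUnit.{u + 1} → A.carrier s) < κ')
  (hB : ∀ t, #(PUnit.{u + 1} → B.carrier t) < κ')

/-- The symbols of the link given by an isomorphism of relational clones: the elements of the
relations that correspond to the relations of unary term operations. -/
abbrev Sym (e : ClosedRelIso κ' A B) (hA : ∀ s, #(PUnit.{u + 1} → A.carrier s) < κ')
    (s : S₁) (t : S₂) : Type u :=
  (e.toFun _ (hA s) (clo A fun _ : PUnit.{u + 1} => s)).rel t

/-- The action of the symbols of the link given by an isomorphism of relational clones. -/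
def action (e : ClosedRelIso κ' A B) (hA : ∀ s, #(PUnit.{u + 1} → A.carrier s) < κ') :
    Action (e.Sym hA) A B :=
  fun _ _ p a => p.1 fun _ => a

/-- Each clause says that some function lies in a generated relation `K` or in a relation of term
operations. It is turned into an inclusion of relations, which can be moved across `e` because `e`
preserves order and `reindex`. -/
theorem isLinkable (e : ClosedRelIso κ' A B) (hκ' : ℵ₀ ≤ κ')
    (hA' : ∀ f : F₁.Op, #((i : F₁.Ar f) → A.carrier (F₁.dom f i)) < κ') :
    IsLinkable (e.action hA) (e.symm.action hB) where
  map_op f t p := by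
    let K : ClosedRel B ((i : F₁.Ar f) → A.carrier (F₁.dom f i)) :=
      span (X := Σ i : F₁.Ar f, Σ t', e.Sym hA (F₁.dom f i) t') (v := fun x => x.2.1)
        fun x (a : (i : F₁.Ar f) → A.carrier (F₁.dom f i)) => e.action hA _ _ x.2.2 (a x.1)
    have h₁ : reindex (fun a _ => A.op f a) (clo A fun _ : PUnit.{u + 1} => F₁.cod f) ≤
        clo A (F₁.dom f) := by
      refine reindex_le ?_
      rintro s _ ⟨U, rfl⟩
      exact Clo.eval_mem A U (fun _ a => A.op f a)
        fun _ => Clo.op_mem A f (fun i a => a i) fun i => ⟨.var i, rfl⟩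
    -- It suffices to place the projections in the preimage of `K`. Projection `i` is a reindexed
    -- unary identity, and the image under `e` of that reindexing consists of the functions `a ↦ p'
    -- (a i)`, which are generators of `K`.
    have h₂ : clo A (F₁.dom f) ≤ e.invFun _ (hA' f) K := by
      refine clo_le fun i => ?_
      have h : reindex (fun a _ => a i) (clo A fun _ : PUnit.{u + 1} => F₁.dom f i) ≤
          e.invFun _ (hA' f) K := by
        rw [← e.le_iff, e.map_reindex hκ' _ (hA _)]
        exact reindex_le fun t' p' hp' => mem_span (X := Σ i : F₁.Ar f, Σ t',
          e.Sym hA (F₁.dom f i) t') (v := fun x => x.2.1)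
          (fun x (a : (i : F₁.Ar f) → A.carrier (F₁.dom f i)) =>
            e.action hA _ _ x.2.2 (a x.1)) ⟨i, t', p', hp'⟩
      exact h _ ⟨fun a => a PUnit.unit, ⟨.var PUnit.unit, rfl⟩, rfl⟩
    have h₃ := (e.le_iff (hA' f)).2 (h₁.trans h₂)
    rw [e.map_reindex hκ' _ (hA _)] at h₃
    obtain ⟨U, hU⟩ := h₃ t ⟨p.1, p.2, rfl⟩
    exact ⟨U, fun a => (congrFun hU a).symm⟩
  comp s t s' p q := by
    -- Unary terms of `B` applied to `p` stay in the subalgebra that contains `p`; applying the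
    -- inverse of `e` replaces these terms by the symbols `q`.
    have h₁ : reindex (fun a _ => p.1 a) (clo B fun _ : PUnit.{u + 1} => t) ≤
        e.toFun _ (hA s) (clo A fun _ => s) := by
      refine reindex_le ?_
      rintro t' _ ⟨U, rfl⟩
      exact ClosedRel.eval_mem _ U _ fun _ => p.2
    have h₂ := e.symm.mono (hA s) h₁
    rw [e.symm.map_reindex hκ' _ (hB _)] at h₂
    simp only [symm, e.left_inv] at h₂
    obtain ⟨U, hU⟩ := h₂ s' ⟨q.1, q.2, rfl⟩
    exact ⟨U, fun a => (congrFun hU fun _ => a).symm⟩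
  recover s := by
    let K : ClosedRel A (PUnit.{u + 1} → A.carrier s) :=
      span (X := Σ t, Σ s', e.Sym hA s t × e.symm.Sym hB t s') (v := fun x => x.2.1)
        fun x (a : PUnit.{u + 1} → A.carrier s) => e.symm.action hB _ _ x.2.2.2
            (e.action hA _ _ x.2.2.1 (a PUnit.unit))
    -- `K` is generated by the composites `q ∘ p`. Once this inclusion is pulled back to `A`, the
    -- identity of `A_s` lies in `K`.
    have h₁ : e.toFun _ (hA s) (clo A fun _ => s) ≤ e.toFun _ (hA s) K := by
      intro t p hp
      have h : reindex (fun a _ => p a) (clo B fun _ : PUnit.{u + 1} => t) ≤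
          e.toFun _ (hA s) K := by
        rw [show e.toFun = e.symm.invFun from rfl, ← e.symm.le_iff,
          e.symm.map_reindex hκ' _ (hB _)]
        exact reindex_le fun s' q hq => mem_span
          (X := Σ t, Σ s', e.Sym hA s t × e.symm.Sym hB t s') (v := fun x => x.2.1)
          (fun x (a : PUnit.{u + 1} → A.carrier s) => e.symm.action hB _ _ x.2.2.2
            (e.action hA _ _ x.2.2.1 (a PUnit.unit)))
          ⟨t, s', ⟨p, hp⟩, ⟨q, hq⟩⟩
      exact h t ⟨fun a => a PUnit.unit, ⟨.var PUnit.unit, rfl⟩, rfl⟩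
    rw [e.le_iff, e.left_inv] at h₁
    obtain ⟨U, hU⟩ := h₁ s ⟨.var PUnit.unit, rfl⟩
    exact ⟨U, fun a => congrFun hU fun _ => a⟩

theorem linked (e : ClosedRelIso κ' A B) (hκ' : ℵ₀ ≤ κ')
    (hA : ∀ s, #(PUnit.{u + 1} → A.carrier s) < κ')
    (hB : ∀ t, #(PUnit.{u + 1} → B.carrier t) < κ')
    (hA' : ∀ f : F₁.Op, #((i : F₁.Ar f) → A.carrier (F₁.dom f i)) < κ')
    (hB' : ∀ f : F₂.Op, #((i : F₂.Ar f) → B.carrier (F₂.dom f i)) < κ') : Linked A B :=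
  (e.isLinkable hA hB hκ' hA').linked (e.symm.isLinkable hB hA hκ' hB')

end ToLink

end ClosedRelIso

/-! ### Back to invariant sets, and the cardinality bound -/

section RelClone

variable {κ κ' : Cardinal.{u}} {A : Algebra F₁} {B : Algebra F₂}

open ClosedRel

/-- The homomorphism of relational clones given by a link. -/
def Link.relCloneHom [Nonempty S₁] [Nonempty S₂] {P : S₁ → S₂ → Type u} {Q : S₂ → S₁ → Type u}
    {T : LinkTerms F₁ F₂ P Q} {T' : LinkTerms F₂ F₁ Q P} (L : Link T T' A B)
    (hS₁ : #S₁ < κ) (hS₂ : #S₂ < κ) (hF₁ : F₁.IsAry κ) (hF₂ : F₂.IsAry κ)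
    (hA : HasPureClone A) (hB : HasPureClone B) : RelCloneHom κ κ' A B where
  toFun _ _ r := invEquiv hS₂ hF₂ hB (L.mapRel ((invEquiv hS₁ hF₁ hA).symm r))
  map_ppDef μ ν U I hμ hI f r q hq := by
    have : (invEquiv hS₁ hF₁ hA).symm q = pp f fun c => (invEquiv hS₁ hF₁ hA).symm (r c) := by
      rw [Equiv.symm_apply_eq]
      refine Subtype.ext (hq.trans ((toSet_pp f _).trans ?_).symm)
      congr 1
      funext c
      exact congrArg Subtype.val ((invEquiv hS₁ hF₁ hA).apply_symm_apply (r c))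
    rw [this, L.mapRel_pp]
    exact toSet_pp f _

theorem Linked.relCloneIsomorphic [Nonempty S₁] [Nonempty S₂] (h : Linked A B)
    (hS₁ : #S₁ < κ) (hS₂ : #S₂ < κ) (hF₁ : F₁.IsAry κ) (hF₂ : F₂.IsAry κ)
    (hA : HasPureClone A) (hB : HasPureClone B) : RelCloneIsomorphic κ κ' A B := by
  obtain ⟨P, Q, T, T', ⟨L⟩⟩ := h
  refine ⟨L.relCloneHom hS₁ hS₂ hF₁ hF₂ hA hB, L.symm.relCloneHom hS₂ hS₁ hF₂ hF₁ hB hA, ?_, ?_⟩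
  · intro μ hμ r
    simp only [Link.relCloneHom, Equiv.symm_apply_apply, L.mapRel_mapRel, Equiv.apply_symm_apply]
  · intro μ hμ r
    have := L.symm.mapRel_mapRel ((invEquiv hS₂ hF₂ hB).symm r)
    simp only [Link.relCloneHom, Equiv.symm_apply_apply]
    change invEquiv hS₂ hF₂ hB (L.symm.symm.mapRel _) = _
    rw [this, Equiv.apply_symm_apply]

theorem RelCloneIsomorphic.nonempty_closedRelIso [Nonempty S₁] [Nonempty S₂]
    (h : RelCloneIsomorphic κ κ' A B)
    (hS₁ : #S₁ < κ) (hS₂ : #S₂ < κ) (hF₁ : F₁.IsAry κ) (hF₂ : F₂.IsAry κ)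
    (hA : HasPureClone A) (hB : HasPureClone B) : Nonempty (ClosedRelIso κ' A B) := by
  obtain ⟨φ, ψ, h₁, h₂⟩ := h
  refine ⟨⟨fun μ hμ R => (invEquiv hS₂ hF₂ hB).symm (φ.toFun μ hμ (invEquiv hS₁ hF₁ hA R)),
    fun μ hμ R => (invEquiv hS₁ hF₁ hA).symm (ψ.toFun μ hμ (invEquiv hS₂ hF₂ hB R)), ?_, ?_, ?_⟩⟩
  · intro μ hμ R
    rw [Equiv.apply_symm_apply, h₁, Equiv.symm_apply_apply]
  · intro μ hμ R
    rw [Equiv.apply_symm_apply, h₂, Equiv.symm_apply_apply]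
  · intro μ ν U I hμ hI f R
    rw [Equiv.symm_apply_eq]
    refine Subtype.ext ((φ.map_ppDef μ ν U I hμ hI f (fun c => invEquiv hS₁ hF₁ hA (R c)) _
      (toSet_pp f R)).trans ((toSet_pp f _).trans ?_).symm)
    congr 1
    funext c
    exact congrArg Subtype.val ((invEquiv hS₂ hF₂ hB).apply_symm_apply _)

/-- By purity, one empty sort makes all sorts empty, and the product has at most one element.
Otherwise `A.Total ^ X` maps onto it. -/
theorem mk_pi_carrier_lt (hA : HasPureClone A) (hκ' : ℵ₀ ≤ κ')
    (hcard : ∀ c : Cardinal.{u}, c < κ → (Cardinal.prod fun s => #(A.carrier s)) ^ c < κ')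
    {X : Type u} (hX : #X < κ) (v : X → S₁) : #((x : X) → A.carrier (v x)) < κ' := by
  by_cases h : ∃ s, IsEmpty (A.carrier s)
  · obtain ⟨s, hs⟩ := h
    have hall : ∀ t, IsEmpty (A.carrier t) := fun t =>
      ⟨fun a => hs.false ((hA t s).some fun _ => a)⟩
    have : Subsingleton ((x : X) → A.carrier (v x)) :=
      ⟨fun a _ => funext fun x => ((hall _).false (a x)).elim⟩
    exact (Cardinal.lt_aleph0_of_finite _).trans_le hκ'
  · have hne : ∀ t, Nonempty (A.carrier t) := fun t => by
      by_contra hn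
      exact h ⟨t, not_nonempty_iff.1 hn⟩
    have hsurj : Function.Surjective
        (fun (a : X → A.Total) (x : X) => a x (v x)) := by
      classical
      intro b
      refine ⟨fun x => Function.update (fun t => (hne t).some) (v x) (b x), ?_⟩
      funext x
      simp
    refine (Cardinal.mk_le_of_surjective hsurj).trans_lt ?_
    have := hcard _ hX
    rwa [← Cardinal.mk_pi, Cardinal.power_def] at this

end RelClone

/-! ### From equivalences of varieties to links -/

section EquivalenceToLink

variable {A : Algebra F₁} {B : Algebra F₂}

/-- The free algebra as an object of the variety. -/
def VarietyCat.free (A : Algebra F) {X : Type u} (v : X → S) : VarietyCat A :=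
  ⟨Free A v, Free.mem_variety A v⟩

/-- The free generators. -/
def VarietyCat.var (A : Algebra F) {X : Type u} (v : X → S) (x : X) :
    (VarietyCat.free A v).obj.carrier (v x) :=
  Free.gen A v x

/-- The term operation given by an element of a free algebra. -/
def VarietyCat.val {A : Algebra F} {X : Type u} {v : X → S} {s : S}
    (g : (VarietyCat.free A v).obj.carrier s) : ((x : X) → A.carrier (v x)) → A.carrier s :=
  g.1

/-- The underlying homomorphism of algebras of a morphism of a variety. -/
def VarietyCat.toHom {C D : VarietyCat A} (h : C ⟶ D) : Hom C.obj D.obj := h.hom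

/-- The morphism from a free algebra given by the images of the generators. -/
noncomputable def VarietyCat.desc {X : Type u} {v : X → S₁} {C : VarietyCat A}
    (c : (x : X) → C.obj.carrier (v x)) : VarietyCat.free A v ⟶ C :=
  ObjectProperty.homMk (Free.lift C.property c)

namespace VarietyCat

variable {C D D' : VarietyCat A} {X : Type u} {v : X → S₁}

theorem toHom_comp (f : C ⟶ D) (g : D ⟶ D') (s : S₁) (x : C.obj.carrier s) :
    (toHom (f ≫ g)).toFun s x = (toHom g).toFun s ((toHom f).toFun s x) := rfl

theorem desc_gen (c : (x : X) → C.obj.carrier (v x)) (x : X) :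
    (toHom (desc c)).toFun (v x) (var A v x) = c x :=
  Free.lift_gen C.property c x

theorem desc_self {s : S₁} (a : (x : X) → A.carrier (v x)) (g : (free A v).obj.carrier s) :
    (toHom (desc (C := gen A) a)).toFun s g = val g a :=
  Free.lift_self a g

theorem free_hom_ext {f g : free A v ⟶ C}
    (h : ∀ x, (toHom f).toFun (v x) (var A v x) = (toHom g).toFun (v x) (var A v x)) :
    f = g :=
  ObjectProperty.hom_ext _ (Free.hom_ext h)

theorem desc_comp (c : (x : X) → C.obj.carrier (v x)) (f : C ⟶ D) :
    desc c ≫ f = desc fun x => (toHom f).toFun _ (c x) :=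
  free_hom_ext fun x => by rw [toHom_comp, desc_gen, desc_gen]

theorem desc_toHom_gen (f : free A v ⟶ C) :
    (desc fun x => (toHom f).toFun _ (var A v x)) = f :=
  free_hom_ext fun x => desc_gen _ x

/-- Elements of sort `s` are morphisms from the free algebra on one generator of sort `s`. -/
theorem injective_of_mono (f : C ⟶ D) [Mono f] {s : S₁} {x y : C.obj.carrier s}
    (h : (toHom f).toFun s x = (toHom f).toFun s y) : x = y := by
  have H : desc (v := fun _ : PUnit.{u + 1} => s) (fun _ => x) = desc fun _ => y := by
    rw [← cancel_mono f, desc_comp, desc_comp, h]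
  rw [← desc_gen (v := fun _ : PUnit.{u + 1} => s) (fun _ => x) PUnit.unit, H, desc_gen]

theorem mono_of_injective (f : C ⟶ D) (h : ∀ s, Function.Injective ((toHom f).toFun s)) :
    Mono f where
  right_cancellation _ _ e := ObjectProperty.hom_ext _ <| Hom.ext <| funext fun s => funext fun x =>
    h s (congrArg (fun k => (toHom k).toFun s x) e)

theorem isIso_of_bijective (f : C ⟶ D) (h : ∀ s, Function.Bijective ((toHom f).toFun s)) :
    IsIso f := by
  choose g hg using fun s => (h s).2
  let g' : Hom D.obj C.obj := ⟨g, fun o a => (h _).1 (by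
    rw [hg, Hom.map_op]
    simp only [hg])⟩
  exact ⟨ObjectProperty.homMk g',
    ObjectProperty.hom_ext _ (Hom.ext (funext fun s => funext fun x => (h s).1 (hg s _))),
    ObjectProperty.hom_ext _ (Hom.ext (funext fun s => funext fun x => hg s x))⟩

theorem surjective_of_isIso (f : C ⟶ D) [IsIso f] (s : S₁) (y : D.obj.carrier s) :
    ∃ x, (toHom f).toFun s x = y :=
  ⟨(toHom (inv f)).toFun s y, by rw [← toHom_comp, IsIso.inv_hom_id]; rfl⟩

/-- The subalgebra generated by a family of elements. -/
def span (C : VarietyCat A) (w : (x : X) → C.obj.carrier (v x)) : VarietyCat A where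
  obj :=
    { carrier := fun s => Set.range fun t : Term F₁ v s => t.eval C.obj w
      op := fun f a => ⟨C.obj.op f fun i => (a i).1, by
        choose t ht using fun i => (a i).2
        exact ⟨.app f t, by simp only [Term.eval]; congr 1; exact funext ht⟩⟩ }
  property := by
    intro Y v' s t₁ t₂ h
    funext a
    have key : ∀ {s} (t : Term F₁ v' s), (t.eval _ a).1 = t.eval C.obj fun x => (a x).1 := by
      intro s t
      induction t with
      | var x => rfl
      | app f t ih => simp only [Term.eval, ← ih]
    exact Subtype.ext ((key t₁).trans ((congrFun (C.property _ _ _ _ _ h) _).trans (key t₂).symm))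

variable (C) (w : (x : X) → C.obj.carrier (v x))

/-- The inclusion of the subalgebra generated by a family of elements. -/
def spanIncl : span C w ⟶ C :=
  ObjectProperty.homMk (show Hom (span C w).obj C.obj from ⟨fun _ a => a.1, fun _ _ => rfl⟩)

theorem spanIncl_mono : Mono (spanIncl C w) :=
  mono_of_injective _ fun _ => Subtype.val_injective

variable {C w}

/-- A morphism with values in the subalgebra generated by `w` factors through it. -/
theorem exists_fac (f : D ⟶ C)
    (h : ∀ s x, ∃ t : Term F₁ v s, t.eval C.obj w = (toHom f).toFun s x) :
    ∃ g, g ≫ spanIncl C w = f :=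
  ⟨ObjectProperty.homMk (show Hom D.obj (span C w).obj from
    ⟨fun s x => ⟨_, h s x⟩, fun o a => Subtype.ext ((toHom f).map_op o a)⟩), rfl⟩

end VarietyCat

open VarietyCat

/-- The symbols of the link given by an equivalence of varieties. -/
abbrev EquivSym (E : VarietyCat A ≌ VarietyCat B) (s : S₁) (t : S₂) : Type u :=
  (E.functor.obj (free A fun _ : PUnit.{u + 1} => s)).obj.carrier t

/-- The action of the symbols of the link given by an equivalence of varieties. -/
noncomputable def equivAction (E : VarietyCat A ≌ VarietyCat B)
    (i : E.functor.obj (gen A) ⟶ gen B) : Action (EquivSym E) A B :=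
  fun _ t z a => (toHom (E.functor.map (desc (C := gen A) fun _ => a) ≫ i)).toFun t z

/-- The free algebra over `dom f` is the coproduct of the free algebras on its single generators.
Equivalences preserve coproducts, so its image under `E` is generated by the images of the summands,
and `E o` sends `p` to a term in these generators. -/
theorem equivAction_op (E : VarietyCat A ≌ VarietyCat B) (i : E.functor.obj (gen A) ⟶ gen B)
    (f : F₁.Op) (t : S₂) (p : EquivSym E (F₁.cod f) t) :
    ∃ U : Term F₂ (X := Σ i : F₁.Ar f, Σ t' : S₂, EquivSym E (F₁.dom f i) t') (fun x => x.2.1) t,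
      ∀ a : (i : F₁.Ar f) → A.carrier (F₁.dom f i),
        equivAction E i _ t p (A.op f a) =
          U.eval B (fun x => equivAction E i _ _ x.2.2 (a x.1)) := by
  let ι : (j : F₁.Ar f) → (free A (fun _ : PUnit.{u + 1} => F₁.dom f j) ⟶ free A (F₁.dom f)) :=
    fun j => desc fun _ => var A (F₁.dom f) j
  let o : free A (fun _ : PUnit.{u + 1} => F₁.cod f) ⟶ free A (F₁.dom f) :=
    desc fun _ => (free A (F₁.dom f)).obj.op f fun j => var A (F₁.dom f) j
  let w : (x : Σ j : F₁.Ar f, Σ t' : S₂, EquivSym E (F₁.dom f j) t') →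
      (E.functor.obj (free A (F₁.dom f))).obj.carrier x.2.1 :=
    fun x => (toHom (E.functor.map (ι x.1))).toFun _ x.2.2
  let m := spanIncl (v := fun x : Σ j : F₁.Ar f, Σ t' : S₂, EquivSym E (F₁.dom f j) t' => x.2.1)
    _ w
  have hfac : ∀ j, ∃ g, g ≫ m = E.functor.map (ι j) := fun j =>
    exists_fac _ fun t' z =>
    ⟨Term.var (⟨j, t', z⟩ : Σ j : F₁.Ar f, Σ t' : S₂, EquivSym E (F₁.dom f j) t'), rfl⟩
  choose g hg using hfac
  -- The factorizations `g j`, transposed to `A`, combine by freeness to a section of the inclusion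
  -- `m`; hence `m` is onto.
  let σ : free A (F₁.dom f) ⟶ E.inverse.obj (VarietyCat.span _ w) :=
    desc fun j => (toHom (E.unit.app _ ≫ E.inverse.map (g j))).toFun _ (var A _ PUnit.unit)
  have hισ : ∀ j, ι j ≫ σ = E.unit.app _ ≫ E.inverse.map (g j) := fun j => by
    rw [desc_comp]
    exact (congrArg _ (funext fun _ => desc_gen _ j)).trans
      (desc_toHom_gen (E.unit.app _ ≫ E.inverse.map (g j)))
  have hσ : σ ≫ E.inverse.map m ≫ E.unitInv.app _ = 𝟙 _ := by
    refine free_hom_ext fun j => ?_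
    have h : ι j ≫ σ ≫ E.inverse.map m ≫ E.unitInv.app _ = ι j := by
      rw [reassoc_of% (hισ j), ← E.inverse.map_comp_assoc, hg]
      simp
    have h' := congrArg (fun k => (toHom k).toFun _
      (var A (fun _ : PUnit.{u + 1} => F₁.dom f j) PUnit.unit)) h
    simp only [toHom_comp] at h'
    rw [show (toHom (ι j)).toFun _ (var A (fun _ : PUnit.{u + 1} => F₁.dom f j) PUnit.unit) =
      var A (F₁.dom f) j from desc_gen _ PUnit.unit] at h'
    exact h'
  have hsplit : ∃ τ, τ ≫ m = 𝟙 _ := by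
    refine ⟨E.functor.map σ ≫ E.counit.app _, ?_⟩
    have h := congrArg E.functor.map hσ
    simpa using h
  obtain ⟨τ, hτ⟩ := hsplit
  obtain ⟨U, hU⟩ : ∃ U : Term F₂ (fun x : Σ j : F₁.Ar f, Σ t' : S₂,
      EquivSym E (F₁.dom f j) t' => x.2.1) t,
      U.eval _ w = (toHom (E.functor.map o)).toFun t p := by
    have h := ((toHom τ).toFun t ((toHom (E.functor.map o)).toFun t p)).2
    obtain ⟨U, hU⟩ := h
    refine ⟨U, hU.trans ?_⟩
    exact congrArg (fun k => (toHom k).toFun t ((toHom (E.functor.map o)).toFun t p)) hτ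
  refine ⟨U, fun a => ?_⟩
  have h₁ : ∀ j, ι j ≫ desc (C := gen A) a = desc (C := gen A) fun _ => a j := fun j => by
    rw [desc_comp]
    exact congrArg _ (funext fun _ => desc_gen _ j)
  have h₂ : o ≫ desc (C := gen A) a = desc (C := gen A) fun _ => A.op f a := by
    rw [desc_comp]
    refine congrArg _ (funext fun _ => ?_)
    exact desc_self (A := A) a _
  unfold equivAction
  rw [← h₂, E.functor.map_comp, Category.assoc, toHom_comp, ← hU, Hom.map_eval]
  congr 1
  funext x
  rw [← h₁, E.functor.map_comp, Category.assoc, toHom_comp]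
  rfl

/-- As a morphism, `p a` is the composite of `desc p`, the image of `a` under `E`, and `i`. Applying
`E.inverse` and naturality of the unit leaves an element of the free algebra on `s`, evaluated at
`a`. -/
theorem equivAction_comp (E : VarietyCat A ≌ VarietyCat B) (i : E.functor.obj (gen A) ⟶ gen B)
    (i' : E.inverse.obj (gen B) ⟶ gen A) (hi : E.inverse.map i ≫ i' = E.unitInv.app _)
    {s : S₁} {t : S₂} {s' : S₁} (p : EquivSym E s t) (q : EquivSym E.symm t s')
    (a : A.carrier s) :
    equivAction E.symm i' t s' q (equivAction E i s t p a) =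
      val ((toHom (E.inverse.map (desc fun _ => p) ≫ E.unitInv.app _)).toFun s' q) fun _ => a := by
  have h : desc (A := B) (C := gen B) (fun _ : PUnit.{u + 1} => equivAction E i s t p a) =
      desc (fun _ => p) ≫ E.functor.map (desc (C := gen A) fun _ => a) ≫ i := by
    rw [desc_comp]
    rfl
  rw [← desc_self (A := A), ← toHom_comp]
  refine congrArg (fun k => (toHom k).toFun s' q) ?_
  change E.inverse.map (desc _) ≫ i' = _
  rw [h]
  simp [hi]

theorem equiv_isLinkable (E : VarietyCat A ≌ VarietyCat B) (i : E.functor.obj (gen A) ⟶ gen B)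
    (i' : E.inverse.obj (gen B) ⟶ gen A) (hi : E.inverse.map i ≫ i' = E.unitInv.app _) :
    IsLinkable (equivAction E i) (equivAction E.symm i') where
  map_op := equivAction_op E i
  comp s t s' p q := by
    obtain ⟨U, hU⟩ := ((toHom (E.inverse.map (desc fun _ => p) ≫ E.unitInv.app _)).toFun s' q).2
    refine ⟨U, fun a => ?_⟩
    rw [equivAction_comp E i i' hi]
    exact (congrFun hU _).symm
  recover s := by
    let w : (x : Σ t : S₂, Σ s' : S₁, EquivSym E s t × EquivSym E.symm t s') →
        (free A fun _ : PUnit.{u + 1} => s).obj.carrier x.2.1 := fun x =>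
      (toHom (E.inverse.map (desc fun _ => x.2.2.1) ≫ E.unitInv.app _)).toFun _ x.2.2.2
    let m := spanIncl (v := fun x : Σ t : S₂, Σ s' : S₁, EquivSym E s t × EquivSym E.symm t s' =>
      x.2.1) _ w
    have : Mono m := spanIncl_mono _ w
    -- Each `z` is a morphism from a free algebra on one generator. Its transpose takes values in
    -- the span of `w`, so `z` lies in the image of `E m`. Thus `E m`, and with it `m`, is an
    -- isomorphism, and the free generator is a term in `w`.
    have hsurj : ∀ t, Function.Bijective ((toHom (E.functor.map m)).toFun t) := by
      refine fun t => ⟨fun x y => injective_of_mono _, fun z => ?_⟩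
      obtain ⟨g, hg⟩ := exists_fac (w := w)
        (E.inverse.map (desc (v := fun _ : PUnit.{u + 1} => t) fun _ => z) ≫ E.unitInv.app _)
        fun s' q => ⟨Term.var (⟨t, s', z, q⟩ :
          Σ t : S₂, Σ s' : S₁, EquivSym E s t × EquivSym E.symm t s'), rfl⟩
      have h : E.counitInv.app _ ≫ E.functor.map g ≫ E.functor.map m =
          desc (v := fun _ : PUnit.{u + 1} => t) fun _ => z := by
        rw [← E.functor.map_comp, hg]
        simp
      refine ⟨(toHom (E.counitInv.app _ ≫ E.functor.map g)).toFun t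
        (var B (fun _ : PUnit.{u + 1} => t) PUnit.unit), ?_⟩
      rw [← toHom_comp, Category.assoc, h]
      exact desc_gen _ PUnit.unit
    have := isIso_of_bijective _ hsurj
    have : IsIso m := isIso_of_reflects_iso m E.functor
    obtain ⟨⟨_, U, hU⟩, hx⟩ := surjective_of_isIso m s
      (var A (fun _ : PUnit.{u + 1} => s) PUnit.unit)
    refine ⟨U, fun a => ?_⟩
    simp only [equivAction_comp E i i' hi]
    refine (Free.val_eval U w fun _ => a).symm.trans ?_
    exact congrArg (fun g => g.1 fun _ => a) (hU.trans hx)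

theorem linked_of_equivalence (E : VarietyCat A ≌ VarietyCat B)
    (i : E.functor.obj (gen A) ≅ gen B) : Linked A B := by
  refine (equiv_isLinkable E i.hom (E.inverse.map i.inv ≫ E.unitInv.app _) (by simp)).linked
    (equiv_isLinkable E.symm (E.inverse.map i.inv ≫ E.unitInv.app _) i.hom ?_)
  -- The inverse unit of `E.symm` is the counit of `E`.
  change E.functor.map (E.inverse.map i.inv ≫ E.unitInv.app _) ≫ i.hom = E.counit.app _
  simp

end EquivalenceToLink

end ManySorted

/-! ### The main theorem -/

theorem mainTheorem6 {S₁ S₂ : Type u} [Nonempty S₁] [Nonempty S₂] (κ κ' : Cardinal.{u})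
    (hκ : ℵ₀ ≤ κ) (hS₁ : #S₁ < κ) (hS₂ : #S₂ < κ)
    (F₁ : ManySorted.Signature S₁) (F₂ : ManySorted.Signature S₂)
    (hF₁ : F₁.IsAry κ) (hF₂ : F₂.IsAry κ)
    (A₁ : ManySorted.Algebra F₁) (A₂ : ManySorted.Algebra F₂)
    (hA₁ : ManySorted.HasPureClone A₁) (hA₂ : ManySorted.HasPureClone A₂)
    (hκ' : ℵ₀ ≤ κ')
    (hcard₁ : ∀ c : Cardinal.{u}, c < κ → (Cardinal.prod fun s => #(A₁.carrier s)) ^ c < κ')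
    (hcard₂ : ∀ c : Cardinal.{u}, c < κ → (Cardinal.prod fun s => #(A₂.carrier s)) ^ c < κ') :
    (∃ E : ManySorted.VarietyCat A₁ ≌ ManySorted.VarietyCat A₂,
      Nonempty (E.functor.obj (ManySorted.VarietyCat.gen A₁) ≅ ManySorted.VarietyCat.gen A₂)) ↔
    ManySorted.RelCloneIsomorphic κ κ' A₁ A₂ := by
  constructor
  · rintro ⟨E, ⟨i⟩⟩
    exact (ManySorted.linked_of_equivalence E i).relCloneIsomorphic hS₁ hS₂ hF₁ hF₂ hA₁ hA₂
  · intro h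
    obtain ⟨e⟩ := h.nonempty_closedRelIso hS₁ hS₂ hF₁ hF₂ hA₁ hA₂
    have h1 : #PUnit.{u + 1} < κ := (Cardinal.lt_aleph0_of_finite _).trans_le hκ
    obtain ⟨P, Q, T, T', ⟨L⟩⟩ := e.linked hκ'
      (fun s => ManySorted.mk_pi_carrier_lt hA₁ hκ' hcard₁ h1 fun _ => s)
      (fun s => ManySorted.mk_pi_carrier_lt hA₂ hκ' hcard₂ h1 fun _ => s)
      (fun f => ManySorted.mk_pi_carrier_lt hA₁ hκ' hcard₁ (hF₁ f) _)
      (fun f => ManySorted.mk_pi_carrier_lt hA₂ hκ' hcard₂ (hF₂ f) _)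
    exact L.exists_equivalence
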